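/- Let $V$ be a finite-dimensional real vector space with its natural (Euclidean) topology. A nonempty subset $C\subseteq V$ is called a strictly convex closed cone if it is closed in $V$, closed under addition and under multiplication by non-negative scalars, and contains no $1$-dimensional linear subspace. A group is called virtually solvable if it has a solvable subgroup of finite index. A subgroup $G$ of $\mathrm{GL}(V)$ is called connected if the Zariski closure of (the image of) $G$ in $\mathrm{GL}(V_{\mathbf C})$, $V_{\mathbf C}=V\otimes_{\mathbf R}\mathbf C$, is connected in the Zariski topology. Theorem 2.1 (Theorem of Lie-Kolchin type for a cone). Let $C\neq\{0\}$ be a strictly convex closed cone in $V$, and let $G$ be a virtually solvable subgroup of $\mathrm{GL}(V)$ such that $g(C)\subseteq C$ for all $g\in G$. Then there are a finite-index subgroup $H$ of $G$ and a vector $v\in C\setminus\{0\}$ such that $h(\mathbf R_{\ge 0}v)=\mathbf R_{\ge 0}v$ for all $h\in H$; that is, $v$ is a common eigenvector of $H$ in $C$. Moreover, if $G$ is connected and solvable, then one may take $H=G$. -/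

import Mathlib

open scoped TensorProduct

/-- A group is virtually solvable if it has a solvable subgroup of finite index. -/
def IsVirtuallySolvable (G : Type*) [Group G] : Prop :=
  ∃ K : Subgroup G, K.FiniteIndex ∧ Group.IsSolvable K

/-- A strictly convex closed cone: a (nonempty) closed subset of a real topological vector space,
closed under addition and under multiplication by nonnegative scalars, and containing no
one-dimensional linear subspace. -/
structure IsStrictlyConvexClosedCone {V : Type*} [AddCommGroup V] [Module ℝ V]
    [TopologicalSpace V] (C : Set V) : Prop where
  nonempty : C.Nonempty
  isClosed : IsClosed C
  add_mem : ∀ x ∈ C, ∀ y ∈ C, x + y ∈ C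
  smul_mem : ∀ c : ℝ, 0 ≤ c → ∀ x ∈ C, c • x ∈ C
  no_line : ∀ L : Submodule ℝ V, Module.finrank ℝ L = 1 → ¬ (L : Set V) ⊆ C

/-- The closed half-line `ℝ_{≥ 0} v`. -/
def halfLine {V : Type*} [AddCommGroup V] [Module ℝ V] (v : V) : Set V :=
  {x | ∃ c : ℝ, 0 ≤ c ∧ x = c • v}

section Zariski

variable (k : Type*) [Field k] (E : Type*) [AddCommGroup E] [Module k E]

/-- The algebra of polynomial functions on a vector space: the `k`-algebra of functions generated
by the linear forms. -/
def polyFunAlgebra : Subalgebra k (E → k) :=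
  Algebra.adjoin k {f | ∃ φ : Module.Dual k E, ∀ x, f x = φ x}

/-- The set of common zeros of a set of functions. -/
def commonZeros {k E : Type*} [Field k] (S : Set (E → k)) : Set E :=
  {x | ∀ f ∈ S, f x = 0}

/-- The Zariski topology on a vector space, viewed as an affine space: the closed sets are the
common zero sets of sets of polynomial functions. -/
@[reducible]
def zariskiTopology : TopologicalSpace E :=
  TopologicalSpace.ofClosed
    {Z | ∃ S : Set (E → k), S ⊆ polyFunAlgebra k E ∧ Z = commonZeros S}
    ⟨{1}, by simp, by
      ext x; simp [commonZeros]⟩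
    (by
      intro A hA
      refine ⟨{f | f ∈ polyFunAlgebra k E ∧ ∃ Z ∈ A, ∀ x ∈ Z, f x = 0},
        fun f hf => hf.1, ?_⟩
      ext x
      constructor
      · rintro hx f ⟨_, Z, hZ, hf⟩
        exact hf x (hx Z hZ)
      · intro hx Z hZ
        obtain ⟨S, hS, rfl⟩ := hA hZ
        exact fun f hf => hx f ⟨hS hf, _, hZ, fun y hy => hy f hf⟩)
    (by
      rintro _ ⟨S, hS, rfl⟩ _ ⟨T, hT, rfl⟩
      refine ⟨{h | ∃ f ∈ S, ∃ g ∈ T, h = f * g}, ?_, ?_⟩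
      · rintro _ ⟨f, hf, g, hg, rfl⟩
        exact mul_mem (hS hf) (hT hg)
      · ext x
        constructor
        · rintro (hx | hx) _ ⟨f, hf, g, hg, rfl⟩
          · simp [hx f hf]
          · simp [hx g hg]
        · intro hx
          by_contra hcon
          simp only [Set.mem_union, commonZeros, Set.mem_ofPred_eq, not_or, not_forall] at hcon
          obtain ⟨⟨f, hf, hfx⟩, ⟨g, hg, hgx⟩⟩ := hcon
          exact mul_ne_zero hfx hgx (hx _ ⟨f, hf, g, hg, rfl⟩))

/-- The Zariski topology on `GL(E)`: the subspace topology from the affine space `End(E)`, in which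
`GL(E)` is the open complement of the zero set of the determinant. -/
@[reducible]
def zariskiTopologyGL : TopologicalSpace (LinearMap.GeneralLinearGroup k E) :=
  TopologicalSpace.induced (fun g => (g : Module.End k E)) (zariskiTopology k (Module.End k E))

end Zariski

/-- The complexification homomorphism `GL(V) → GL(V_ℂ)`, where `V_ℂ = ℂ ⊗ V`. -/
noncomputable def complexifyGL (V : Type*) [AddCommGroup V] [Module ℝ V] :
    LinearMap.GeneralLinearGroup ℝ V →* LinearMap.GeneralLinearGroup ℂ (ℂ ⊗[ℝ] V) :=
  Units.map (Module.End.baseChangeHom ℝ ℂ V : Module.End ℝ V →* Module.End ℂ (ℂ ⊗[ℝ] V))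

/-- A subgroup of `GL(V)`, `V` a real vector space, is called connected if its Zariski closure
in `GL(V_ℂ)` is connected. -/
def IsZariskiConnected {V : Type*} [AddCommGroup V] [Module ℝ V]
    (G : Subgroup (LinearMap.GeneralLinearGroup ℝ V)) : Prop :=
  letI := zariskiTopologyGL ℂ (ℂ ⊗[ℝ] V)
  IsConnected (closure (complexifyGL V '' (G : Set (LinearMap.GeneralLinearGroup ℝ V))))

/-! Zariski connectedness enters only through one consequence: the group stabilizes every subspace
with finite orbit (`IsStabilizerConnected`). Every linear group has a finite-index subgroup with
this property (`stabilizerComponent`), so both claims reduce to solvable stabilizer-connected groups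
`G`, treated by induction on the derived length.

Let `N` be the component of `⁅G, G⁆`. By induction `N` has an eigenvector `v` in the cone, with
character `χ`. The finitely many nonzero weight spaces of `N` are permuted by `G`, hence each is
stable. Elements of `⁅G, G⁆` have determinant 1 on such a space, so `χ` takes values in roots of
unity; being positive, it is trivial. Thus `v` has finite orbit under `⁅G, G⁆`, and the sum of the
orbit is a fixed vector, nonzero because the cone contains no line. On the part of the cone fixed by
`⁅G, G⁆` the elements of `G` commute.

Commuting operators are handled by convexity (`exists_common_eigenvector`): an extreme ray of a
minimal invariant subcone is an eigenray of all of them. -/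

namespace IsStrictlyConvexClosedCone

/-! ### Elementary properties of cones -/

section TopologicalSpace

variable {V : Type*} [AddCommGroup V] [Module ℝ V] [TopologicalSpace V] {C : Set V}

theorem zero_mem (hC : IsStrictlyConvexClosedCone C) : (0 : V) ∈ C := by
  obtain ⟨x, hx⟩ := hC.nonempty
  simpa using hC.smul_mem 0 le_rfl x hx

theorem eq_zero_of_neg_mem (hC : IsStrictlyConvexClosedCone C) {x : V} (hx : x ∈ C)
    (hx' : -x ∈ C) : x = 0 := by
  by_contra h
  refine hC.no_line (Submodule.span ℝ {x}) (finrank_span_singleton h) ?_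
  intro y hy
  obtain ⟨c, rfl⟩ := Submodule.mem_span_singleton.1 hy
  rcases le_total 0 c with hc | hc
  · exact hC.smul_mem c hc x hx
  · simpa using hC.smul_mem (-c) (by linarith) (-x) hx'

theorem eq_zero_of_add_eq_zero (hC : IsStrictlyConvexClosedCone C) {x y : V} (hx : x ∈ C)
    (hy : y ∈ C) (h : x + y = 0) : x = 0 :=
  hC.eq_zero_of_neg_mem hx (by rwa [neg_eq_of_add_eq_zero_right h])

theorem sum_mem (hC : IsStrictlyConvexClosedCone C) {ι : Type*} (s : Finset ι) (f : ι → V)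
    (hf : ∀ i ∈ s, f i ∈ C) : ∑ i ∈ s, f i ∈ C :=
  Finset.sum_induction f (· ∈ C) (fun x y hx hy => hC.add_mem x hx y hy) hC.zero_mem hf

theorem exists_ne_zero (hC : IsStrictlyConvexClosedCone C) (hC0 : C ≠ {0}) :
    ∃ x ∈ C, x ≠ 0 := by
  by_contra! h
  exact hC0 (Set.eq_singleton_iff_unique_mem.2 ⟨hC.zero_mem, h⟩)

theorem convex (hC : IsStrictlyConvexClosedCone C) : Convex ℝ C :=
  fun x hx y hy a b ha hb _ => hC.add_mem _ (hC.smul_mem a ha x hx) _ (hC.smul_mem b hb y hy)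

/-- A closed subset of a strictly convex closed cone that is stable under addition and
nonnegative scalars is again such a cone. -/
theorem of_subset (hC : IsStrictlyConvexClosedCone C) {D : Set V} (hDC : D ⊆ C)
    (hne : D.Nonempty) (hcl : IsClosed D) (hadd : ∀ x ∈ D, ∀ y ∈ D, x + y ∈ D)
    (hsmul : ∀ c : ℝ, 0 ≤ c → ∀ x ∈ D, c • x ∈ D) : IsStrictlyConvexClosedCone D :=
  ⟨hne, hcl, hadd, hsmul, fun L hL h => hC.no_line L hL (h.trans hDC)⟩

end TopologicalSpace

/-! ### Convex geometry of cones and commuting operators -/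

section Normed

variable {E : Type*} [NormedAddCommGroup E] [NormedSpace ℝ E] {C : Set E}

/-- A point outside the cone is separated from it by a functional that is nonnegative on the
cone. -/
theorem exists_dual_neg (hC : IsStrictlyConvexClosedCone C) {x : E} (hx : x ∉ C) :
    ∃ f : E →L[ℝ] ℝ, (∀ y ∈ C, 0 ≤ f y) ∧ f x < 0 := by
  obtain ⟨f, u, hfx, hf⟩ := geometric_hahn_banach_point_closed hC.convex hC.isClosed hx
  have hu : u < 0 := by simpa using hf 0 hC.zero_mem
  refine ⟨f, fun y hy => ?_, hfx.trans hu⟩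
  by_contra! hy0
  -- This multiple of `y` lies in the cone and has value exactly `u`, against strict separation.
  have := hf _ (hC.smul_mem (u / f y) (div_nonneg_of_nonpos hu.le hy0.le) y hy)
  rw [map_smul, smul_eq_mul, div_mul_cancel₀ _ hy0.ne] at this
  exact lt_irrefl _ this

variable [FiniteDimensional ℝ E]

/-- There is a functional that is positive on the nonzero vectors of the cone. -/
theorem exists_dual_pos (hC : IsStrictlyConvexClosedCone C) :
    ∃ f : E →L[ℝ] ℝ, ∀ y ∈ C, y ≠ 0 → 0 < f y := by
  set D : Set (E →L[ℝ] ℝ) := {f | ∀ y ∈ C, 0 ≤ f y} with hD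
  -- The sum of a finite subset `t` of the dual cone with the same span works: if it vanishes at
  -- `y`, so does the whole dual cone, and then `-y` cannot be separated from `C`.
  obtain ⟨t, htD, hspan, hli⟩ := exists_linearIndependent ℝ D
  have hfin : t.Finite := hli.setFinite
  refine ⟨∑ f ∈ hfin.toFinset, f, fun y hy hy0 => ?_⟩
  have hnn : ∀ f ∈ hfin.toFinset, 0 ≤ f y := fun f hf => htD (by simpa using hf) y hy
  rw [sum_apply]
  refine lt_of_le_of_ne (Finset.sum_nonneg hnn) fun h0 => hy0 ?_
  have hz : ∀ f ∈ t, f y = 0 := fun f hf =>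
    (Finset.sum_eq_zero_iff_of_nonneg hnn).1 h0.symm f (by simpa using hf)
  have hDz : ∀ f ∈ D, f y = 0 := by
    intro f hf
    have hf' : f ∈ Submodule.span ℝ t := hspan ▸ Submodule.subset_span hf
    have hle : Submodule.span ℝ t ≤
        LinearMap.ker (ContinuousLinearMap.apply ℝ ℝ y : (E →L[ℝ] ℝ) →L[ℝ] ℝ).toLinearMap :=
      Submodule.span_le.2 fun g hg => by simpa using hz g hg
    simpa using hle hf'
  refine hC.eq_zero_of_neg_mem hy ?_
  by_contra hneg
  obtain ⟨f, hf, hfy⟩ := hC.exists_dual_neg hneg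
  simp [hDz f hf] at hfy

/-- The slice of the cone by a level set of a positive functional is compact. -/
theorem isCompact_slice (hC : IsStrictlyConvexClosedCone C) {f : E →L[ℝ] ℝ}
    (hf : ∀ y ∈ C, y ≠ 0 → 0 < f y) : IsCompact {x ∈ C | f x = 1} := by
  have hcl : IsClosed {x ∈ C | f x = 1} :=
    hC.isClosed.inter (isClosed_eq f.continuous continuous_const)
  have hcs : IsCompact (Metric.sphere (0 : E) 1 ∩ C) := (isCompact_sphere 0 1).inter_right hC.isClosed
  obtain ⟨c, hc, hcf⟩ : ∃ c : ℝ, 0 < c ∧ ∀ x ∈ Metric.sphere (0 : E) 1 ∩ C, c ≤ f x := by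
    rcases (Metric.sphere (0 : E) 1 ∩ C).eq_empty_or_nonempty with he | hne
    · exact ⟨1, one_pos, by simp [he]⟩
    · obtain ⟨x, hx, hmin⟩ := hcs.exists_isMinOn hne f.continuous.continuousOn
      refine ⟨f x, hf x hx.2 ?_, fun y hy => hmin hy⟩
      rintro rfl
      simpa using hx.1
  refine Metric.isCompact_of_isClosed_isBounded hcl
    ((Metric.isBounded_closedBall (x := (0 : E)) (r := c⁻¹)).subset ?_)
  rintro x ⟨hx, hfx⟩
  have hx0 : x ≠ 0 := by rintro rfl; simp at hfx
  have hn : 0 < ‖x‖ := norm_pos_iff.2 hx0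
  have := hcf (‖x‖⁻¹ • x) ⟨by simp [norm_smul, hn.ne'], hC.smul_mem _ (by positivity) x hx⟩
  rw [map_smul, hfx, smul_eq_mul, mul_one] at this
  simpa using (le_inv_comm₀ hc hn).1 this

/-- A nonzero strictly convex closed cone has an extreme ray. -/
theorem exists_extreme_ray (hC : IsStrictlyConvexClosedCone C) (hC0 : C ≠ {0}) :
    ∃ x ∈ C, x ≠ 0 ∧ ∀ y ∈ C, ∀ z ∈ C, y + z = x → ∃ c : ℝ, y = c • x := by
  obtain ⟨f, hf⟩ := hC.exists_dual_pos
  obtain ⟨w, hw, hw0⟩ := hC.exists_ne_zero hC0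
  have hfw := hf w hw hw0
  obtain ⟨x, ⟨hx, hfx⟩, hext⟩ := (hC.isCompact_slice hf).extremePoints_nonempty
    ⟨(f w)⁻¹ • w, hC.smul_mem _ (by positivity) w hw, by simp [hfw.ne']⟩
  refine ⟨x, hx, by rintro rfl; simp at hfx, fun y hy z hz hyz => ?_⟩
  by_cases hy0 : y = 0
  · exact ⟨0, by simp [hy0]⟩
  by_cases hz0 : z = 0
  · exact ⟨1, by simpa [hz0] using hyz⟩
  have hfy := hf y hy hy0
  have hfz := hf z hz hz0
  have hsum : f y + f z = 1 := by rw [← map_add, hyz, hfx]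
  -- `x` is a convex combination, with weights `f y` and `f z`, of the rescalings of `y` and `z` to
  -- the slice.
  have key := hext (x₁ := (f y)⁻¹ • y) ⟨hC.smul_mem _ (by positivity) y hy, by simp [hfy.ne']⟩
    (x₂ := (f z)⁻¹ • z) ⟨hC.smul_mem _ (by positivity) z hz, by simp [hfz.ne']⟩
    ⟨f y, f z, hfy, hfz, hsum, by simp [smul_smul, hfy.ne', hfz.ne', hyz]⟩
  refine ⟨f y, ?_⟩
  rw [← key, smul_smul, mul_inv_cancel₀ hfy.ne', one_smul]

/-- For every operator preserving the cone there are a scalar `μ` and a nonzero vector `y` of the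
cone with `g y ≤ μ y` in the order defined by the cone. -/
theorem exists_smul_sub_mem (hC : IsStrictlyConvexClosedCone C) (hC0 : C ≠ {0})
    (g : E →L[ℝ] E) (hg : ∀ x ∈ C, g x ∈ C) :
    ∃ μ : ℝ, 0 < μ ∧ ∃ y ∈ C, y ≠ 0 ∧ μ • y - g y ∈ C := by
  obtain ⟨x, hx, hx0⟩ := hC.exists_ne_zero hC0
  have hμ : 0 < ‖g‖ + 1 := by positivity
  have : CompleteSpace E := FiniteDimensional.complete ℝ E
  -- Since `μ > ‖g‖`, the Neumann series of `a = g / μ` converges. Its value at `x` is the required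
  -- `y`: it lies in the closed cone and satisfies `y - a y = x`.
  set μ := ‖g‖ + 1 with hμdef
  set a : E →L[ℝ] E := μ⁻¹ • g with ha
  have hanorm : ‖a‖ < 1 := by
    rw [ha, norm_smul, norm_inv, Real.norm_of_nonneg hμ.le, inv_mul_lt_one₀ hμ]
    linarith
  have haC : ∀ n : ℕ, ∀ y ∈ C, (a ^ n) y ∈ C := by
    intro n
    induction n with
    | zero => simp
    | succ n ih =>
      intro y hy
      rw [pow_succ]
      exact ih _ (hC.smul_mem _ (by positivity) _ (hg y hy))
  have hsum := (summable_geometric_of_norm_lt_one hanorm).hasSum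
  have hsumx : HasSum (fun n => (a ^ n) x) ((∑' n, a ^ n) x) :=
    hsum.mapL (ContinuousLinearMap.apply ℝ E x)
  have hyC : (∑' n, a ^ n) x ∈ C :=
    hC.isClosed.mem_of_tendsto hsumx (Filter.Eventually.of_forall fun s =>
      hC.sum_mem s _ fun n _ => haC n x hx)
  have hinv : (∑' n, a ^ n) x - a ((∑' n, a ^ n) x) = x := by
    have := congrArg (fun b : E →L[ℝ] E => b x) (mul_neg_geom_series a hanorm)
    simpa using this
  refine ⟨μ, hμ, _, hyC, ?_, ?_⟩
  · intro h0
    rw [h0] at hinv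
    exact hx0 (by simpa using hinv.symm)
  · have : μ • (∑' n, a ^ n) x - g ((∑' n, a ^ n) x) = μ • x := by
      conv_rhs => rw [← hinv]
      rw [ha, smul_sub, smul_apply, smul_inv_smul₀ hμ.ne']
    rw [this]
    exact hC.smul_mem _ hμ.le x hx

/-- Among the nonzero closed subcones stable under a set of operators there is a minimal one. -/
theorem exists_minimal_invariant (hC : IsStrictlyConvexClosedCone C) (hC0 : C ≠ {0})
    (M : Set (E →L[ℝ] E)) (hM : ∀ g ∈ M, ∀ x ∈ C, g x ∈ C) :
    ∃ K ⊆ C, Minimal (fun K : Set E => K ⊆ C ∧ IsStrictlyConvexClosedCone K ∧ K ≠ {0} ∧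
      ∀ g ∈ M, ∀ x ∈ K, g x ∈ K) K := by
  obtain ⟨f, hf⟩ := hC.exists_dual_pos
  refine zorn_superset_nonempty {K : Set E | K ⊆ C ∧ IsStrictlyConvexClosedCone K ∧ K ≠ {0} ∧
      ∀ g ∈ M, ∀ x ∈ K, g x ∈ K} ?_ C ⟨subset_rfl, hC, hC0, hM⟩
  intro c hc hchain hne
  have hne' : Nonempty c := hne.to_subtype
  -- Compactness of the slices keeps the intersection of a chain from shrinking to `{0}`.
  have hslice : (⋂ K : c, {x ∈ (K : Set E) | f x = 1}).Nonempty := by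
    refine IsCompact.nonempty_iInter_of_directed_nonempty_isCompact_isClosed _ ?_ ?_ ?_ ?_
    · intro K L
      rcases hchain.total K.2 L.2 with h | h
      · exact ⟨K, subset_rfl, fun x hx => ⟨h hx.1, hx.2⟩⟩
      · exact ⟨L, fun x hx => ⟨h hx.1, hx.2⟩, subset_rfl⟩
    · intro K
      obtain ⟨hKC, hK, hK0, -⟩ := hc K.2
      obtain ⟨w, hw, hw0⟩ := hK.exists_ne_zero hK0
      have hfw := hf w (hKC hw) hw0
      exact ⟨(f w)⁻¹ • w, hK.smul_mem _ (by positivity) w hw, by simp [hfw.ne']⟩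
    · intro K
      obtain ⟨hKC, hK, -, -⟩ := hc K.2
      exact hK.isCompact_slice fun y hy => hf y (hKC hy)
    · intro K
      exact (hc K.2).2.1.isClosed.inter (isClosed_eq f.continuous continuous_const)
  obtain ⟨w, hw⟩ := hslice
  have hw' : ∀ K ∈ c, w ∈ K ∧ f w = 1 := fun K hK => Set.mem_iInter.1 hw ⟨K, hK⟩
  obtain ⟨K₀, hK₀⟩ := hne
  have hsub : ⋂₀ c ⊆ C := (Set.sInter_subset_of_mem hK₀).trans (hc hK₀).1
  refine ⟨⋂₀ c, ⟨hsub, hC.of_subset hsub ⟨w, fun K hK => (hw' K hK).1⟩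
    (isClosed_sInter fun K hK => (hc hK).2.1.isClosed)
    (fun x hx y hy K hK => (hc hK).2.1.add_mem x (hx K hK) y (hy K hK))
    (fun r hr x hx K hK => (hc hK).2.1.smul_mem r hr x (hx K hK)), ?_,
    fun g hg x hx K hK => (hc hK).2.2.2 g hg x (hx K hK)⟩, fun K hK => Set.sInter_subset_of_mem hK⟩
  intro h0
  have hw0 : w ∈ ⋂₀ c := fun K hK => (hw' K hK).1
  rw [h0, Set.mem_singleton_iff] at hw0
  have := (hw' K₀ hK₀).2
  simp [hw0] at this

/-- Operators preserving a nonzero strictly convex closed cone and commuting on it have a common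
eigenvector in the cone. -/
theorem exists_common_eigenvector_of_normed (hC : IsStrictlyConvexClosedCone C) (hC0 : C ≠ {0})
    (M : Set (E →L[ℝ] E)) (hM : ∀ g ∈ M, ∀ x ∈ C, g x ∈ C)
    (hcomm : ∀ g ∈ M, ∀ h ∈ M, ∀ x ∈ C, g (h x) = h (g x)) :
    ∃ v ∈ C, v ≠ 0 ∧ ∀ g ∈ M, ∃ c : ℝ, g v = c • v := by
  obtain ⟨K, hKC, ⟨-, hK, hK0, hKM⟩, hmin⟩ := hC.exists_minimal_invariant hC0 M hM
  obtain ⟨x, hx, hx0, hext⟩ := hK.exists_extreme_ray hK0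
  refine ⟨x, hKC hx, hx0, fun g hg => ?_⟩
  obtain ⟨μ, hμ, y, hy, hy0, hyK⟩ := hK.exists_smul_sub_mem hK0 g (hKM g hg)
  -- Commutation makes `K'` invariant, so minimality gives `K' = K`. Then `x` is the sum of `μ⁻¹ • g
  -- x` and `μ⁻¹ • (μ • x - g x)`, both in `K`, and extremality makes `g x` a multiple of `x`.
  set K' : Set E := {z ∈ K | μ • z - g z ∈ K} with hK'
  have hsub : K' ⊆ K := fun z hz => hz.1
  have hK'cone : IsStrictlyConvexClosedCone K' := by
    refine hK.of_subset hsub ⟨y, hy, hyK⟩ (hK.isClosed.inter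
      (hK.isClosed.preimage ((continuous_const_smul μ).sub g.continuous))) ?_ ?_
    · rintro a ⟨ha, ha'⟩ b ⟨hb, hb'⟩
      refine ⟨hK.add_mem a ha b hb, ?_⟩
      rw [smul_add, map_add, add_sub_add_comm]
      exact hK.add_mem _ ha' _ hb'
    · rintro c hc a ⟨ha, ha'⟩
      refine ⟨hK.smul_mem c hc a ha, ?_⟩
      rw [map_smul, smul_comm, ← smul_sub]
      exact hK.smul_mem c hc _ ha'
  have hle : K ⊆ K' := by
    refine hmin ⟨hsub.trans hKC, hK'cone, ?_, ?_⟩ hsub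
    · intro h0
      have : y ∈ K' := ⟨hy, hyK⟩
      rw [h0] at this
      exact hy0 this
    · rintro h hh z ⟨hz, hz'⟩
      refine ⟨hKM h hh z hz, ?_⟩
      rw [hcomm g hg h hh z (hKC hz), ← map_smul, ← map_sub]
      exact hKM h hh _ hz'
  obtain ⟨c, hc⟩ := hext (μ⁻¹ • g x) (hK.smul_mem _ (by positivity) _ (hKM g hg x hx))
    (μ⁻¹ • (μ • x - g x)) (hK.smul_mem _ (by positivity) _ (hle hx).2)
    (by rw [smul_sub, inv_smul_smul₀ hμ.ne']; abel)
  refine ⟨μ * c, ?_⟩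
  rw [mul_smul, ← hc, smul_inv_smul₀ hμ.ne']

end Normed

/-- Operators preserving a nonzero strictly convex closed cone and commuting on it have a common
eigenvector in the cone. -/
theorem exists_common_eigenvector {V : Type*} [AddCommGroup V] [Module ℝ V]
    [FiniteDimensional ℝ V] [TopologicalSpace V] [IsTopologicalAddGroup V] [ContinuousSMul ℝ V]
    [T2Space V] {C : Set V} (hC : IsStrictlyConvexClosedCone C) (hC0 : C ≠ {0})
    (M : Set (V →ₗ[ℝ] V)) (hM : ∀ g ∈ M, ∀ x ∈ C, g x ∈ C)
    (hcomm : ∀ g ∈ M, ∀ h ∈ M, ∀ x ∈ C, g (h x) = h (g x)) :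
    ∃ v ∈ C, v ≠ 0 ∧ ∀ g ∈ M, ∃ c : ℝ, g v = c • v := by
  let e : V ≃L[ℝ] EuclideanSpace ℝ (Fin (Module.finrank ℝ V)) :=
    ContinuousLinearEquiv.ofFinrankEq (by simp)
  let j : (V →ₗ[ℝ] V) → (EuclideanSpace ℝ (Fin (Module.finrank ℝ V)) →L[ℝ]
      EuclideanSpace ℝ (Fin (Module.finrank ℝ V))) := fun g =>
    LinearMap.toContinuousLinearMap (e.toLinearMap ∘ₗ g ∘ₗ e.symm.toLinearMap)
  have hj : ∀ g x, j g (e x) = e (g x) := fun g x => by simp [j]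
  have hcone : IsStrictlyConvexClosedCone (e '' C) := by
    refine ⟨hC.nonempty.image e, e.toHomeomorph.isClosed_image.2 hC.isClosed, ?_, ?_, ?_⟩
    · rintro _ ⟨x, hx, rfl⟩ _ ⟨y, hy, rfl⟩
      exact ⟨x + y, hC.add_mem x hx y hy, map_add e x y⟩
    · rintro c hc _ ⟨x, hx, rfl⟩
      exact ⟨c • x, hC.smul_mem c hc x hx, map_smul e c x⟩
    · intro L hL hLC
      refine hC.no_line (L.map e.symm.toLinearEquiv.toLinearMap)
        ((LinearEquiv.finrank_map_eq e.symm.toLinearEquiv L).trans hL) ?_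
      rintro _ ⟨y, hy, rfl⟩
      obtain ⟨x, hx, rfl⟩ := hLC hy
      simpa using hx
  obtain ⟨_, ⟨v, hv, rfl⟩, hv0, hev⟩ := hcone.exists_common_eigenvector_of_normed
    (by
      obtain ⟨x, hx, hx0⟩ := hC.exists_ne_zero hC0
      intro h
      have := h ▸ Set.mem_image_of_mem e hx
      exact hx0 (by simpa using this))
    (j '' M)
    (by
      rintro _ ⟨g, hg, rfl⟩ _ ⟨x, hx, rfl⟩
      exact ⟨g x, hM g hg x hx, (hj g x).symm⟩)
    (by
      rintro _ ⟨g, hg, rfl⟩ _ ⟨h, hh, rfl⟩ _ ⟨x, hx, rfl⟩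
      simp only [hj, hcomm g hg h hh x hx])
  refine ⟨v, hv, by rintro rfl; simp at hv0, fun g hg => ?_⟩
  obtain ⟨c, hc⟩ := hev _ ⟨g, hg, rfl⟩
  refine ⟨c, e.injective ?_⟩
  rw [← hj, hc, map_smul]

end IsStrictlyConvexClosedCone

open scoped Pointwise Topology
open MulAction

/-! ### Stabilizer-connected groups and the finite-index component -/

section StabilizerConnected

variable {k V : Type*} [Field k] [AddCommGroup V] [Module k V]

namespace LinearMap.GeneralLinearGroup

theorem smul_submodule_eq_of_le [FiniteDimensional k V]
    (g : LinearMap.GeneralLinearGroup k V) {U W : Submodule k V}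
    (hd : Module.finrank k U = Module.finrank k W) (h : g • U ≤ W) : g • U = W := by
  refine Submodule.eq_of_le_of_finrank_eq h ?_
  rw [← hd]
  exact LinearEquiv.finrank_map_eq (LinearMap.GeneralLinearGroup.toLinearEquiv g) U

theorem mem_stabilizer_submodule_iff [FiniteDimensional k V]
    (g : LinearMap.GeneralLinearGroup k V) (U : Submodule k V) :
    g ∈ stabilizer (LinearMap.GeneralLinearGroup k V) U ↔ ∀ u ∈ U, g • u ∈ U := by
  constructor
  · intro h u hu
    have := Submodule.smul_mem_pointwise_smul u (g : Module.End k V) U hu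
    rw [mem_stabilizer_iff] at h
    exact h ▸ this
  · intro h
    refine smul_submodule_eq_of_le g rfl ?_
    rintro _ ⟨u, hu, rfl⟩
    exact h u hu

end LinearMap.GeneralLinearGroup

open LinearMap.GeneralLinearGroup

/-- A linear group is stabilizer-connected if it stabilizes every subspace whose stabilizer in
the group has finite index. -/
def IsStabilizerConnected (G : Subgroup (LinearMap.GeneralLinearGroup k V)) : Prop :=
  ∀ U : Submodule k V, (stabilizer (LinearMap.GeneralLinearGroup k V) U).relIndex G ≠ 0 →
    G ≤ stabilizer (LinearMap.GeneralLinearGroup k V) U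

/-- The subgroup of the elements of `G` that stabilize every subspace with finite `G`-orbit. -/
def stabilizerComponent (G : Subgroup (LinearMap.GeneralLinearGroup k V)) :
    Subgroup (LinearMap.GeneralLinearGroup k V) :=
  G ⊓ ⨅ U : {U : Submodule k V //
    (stabilizer (LinearMap.GeneralLinearGroup k V) U).relIndex G ≠ 0},
      stabilizer (LinearMap.GeneralLinearGroup k V) (U : Submodule k V)

theorem stabilizerComponent_le (G : Subgroup (LinearMap.GeneralLinearGroup k V)) :
    stabilizerComponent G ≤ G := inf_le_left

/-- The intersection of stabilizers of arbitrarily many subspaces is the intersection of finitely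
many of them, since the endomorphisms preserving a subspace form a linear subspace. -/
theorem exists_finset_iInf_stabilizer_le [FiniteDimensional k V] (I : Set (Submodule k V)) :
    ∃ t : Finset (Submodule k V), ↑t ⊆ I ∧ ∀ U ∈ I,
      ⨅ W : t, stabilizer (LinearMap.GeneralLinearGroup k V) (W : Submodule k V) ≤
        stabilizer (LinearMap.GeneralLinearGroup k V) U := by
  classical
  let A : Submodule k V → Submodule k (Module.End k V) := fun U =>
    { carrier := {a | ∀ u ∈ U, a u ∈ U}
      add_mem' := fun ha hb u hu => U.add_mem (ha u hu) (hb u hu)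
      zero_mem' := fun u _ => U.zero_mem
      smul_mem' := fun c _ ha u hu => U.smul_mem c (ha u hu) }
  have hA : ∀ (g : LinearMap.GeneralLinearGroup k V) U,
      g ∈ stabilizer (LinearMap.GeneralLinearGroup k V) U ↔ (g : Module.End k V) ∈ A U :=
    fun g U => mem_stabilizer_submodule_iff g U
  -- A minimal finite intersection of the spaces `A U` cannot shrink when another `U` is added, so
  -- it lies in all of them.
  obtain ⟨_, ⟨t, ht, rfl⟩, hmin⟩ := WellFounded.has_min
    (wellFounded_lt (α := Submodule k (Module.End k V)))
    {B | ∃ t : Finset (Submodule k V), ↑t ⊆ I ∧ t.inf A = B} ⟨_, ∅, by simp, rfl⟩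
  refine ⟨t, ht, fun U hU g hg => ?_⟩
  have hle : t.inf A ≤ A U := by
    have h1 : (insert U t).inf A ≤ t.inf A := Finset.inf_mono (Finset.subset_insert U t)
    have h2 := eq_of_le_of_not_lt h1 (hmin _ ⟨insert U t, by
      rw [Finset.coe_insert]; exact Set.insert_subset hU ht, rfl⟩)
    rw [← h2]
    exact Finset.inf_le (Finset.mem_insert_self U t)
  rw [hA]
  apply hle
  rw [Submodule.mem_finsetInf]
  intro W hW
  rw [← hA]
  exact Subgroup.mem_iInf.1 hg ⟨W, hW⟩

theorem relIndex_stabilizerComponent_ne_zero [FiniteDimensional k V]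
    (G : Subgroup (LinearMap.GeneralLinearGroup k V)) :
    (stabilizerComponent G).relIndex G ≠ 0 := by
  obtain ⟨t, ht, hle⟩ := exists_finset_iInf_stabilizer_le {U : Submodule k V |
    (stabilizer (LinearMap.GeneralLinearGroup k V) U).relIndex G ≠ 0}
  have hfin : (⨅ W : t, stabilizer (LinearMap.GeneralLinearGroup k V)
      (W : Submodule k V)).relIndex G ≠ 0 :=
    Subgroup.relIndex_iInf_ne_zero fun W => ht W.2
  have hself : G.relIndex G ≠ 0 := by
    rw [Subgroup.relIndex_self]
    exact one_ne_zero
  refine Subgroup.relIndex_inf_ne_zero hself fun h0 => hfin ?_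
  refine Subgroup.relIndex_eq_zero_of_le_left (le_iInf ?_) h0
  rintro ⟨U, hU⟩
  exact hle U hU

/-- Finite index is transitive: a subspace whose stabilizer has finite index in the component
already occurs in the intersection defining the component. -/
theorem isStabilizerConnected_stabilizerComponent
    [FiniteDimensional k V] (G : Subgroup (LinearMap.GeneralLinearGroup k V)) :
    IsStabilizerConnected (stabilizerComponent G) := fun U hU =>
  inf_le_right.trans (iInf_le _ (⟨U, Subgroup.relIndex_ne_zero_trans hU
    (relIndex_stabilizerComponent_ne_zero G)⟩ : {U : Submodule k V //
      (stabilizer (LinearMap.GeneralLinearGroup k V) U).relIndex G ≠ 0}))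

/-- The normalizer of `G` permutes the subspaces with finite `G`-orbit. This makes the component of
`⁅G, G⁆` stable under conjugation by `G`. -/
theorem conj_mem_stabilizerComponent {G : Subgroup (LinearMap.GeneralLinearGroup k V)}
    {g n : LinearMap.GeneralLinearGroup k V} (hg : g ∈ Subgroup.normalizer (G : Set _))
    (hn : n ∈ stabilizerComponent G) : g * n * g⁻¹ ∈ stabilizerComponent G := by
  refine ⟨(Subgroup.mem_normalizer_iff.1 hg n).1 hn.1, Subgroup.mem_iInf.2 fun ⟨U, hU⟩ => ?_⟩
  have hconj : MulAut.conj g⁻¹ • G = G :=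
    Subgroup.mem_normalizer_iff_map_conj_eq.1 (inv_mem hg)
  have hU' : (stabilizer (LinearMap.GeneralLinearGroup k V) (g⁻¹ • U)).relIndex G ≠ 0 := by
    rw [stabilizer_smul_eq_stabilizer_map_conj]
    have := Subgroup.relIndex_pointwise_smul (MulAut.conj g⁻¹)
      (stabilizer (LinearMap.GeneralLinearGroup k V) U) G
    rw [hconj] at this
    exact this.trans_ne hU
  have := Subgroup.mem_iInf.1 hn.2 ⟨g⁻¹ • U, hU'⟩
  rw [mem_stabilizer_iff] at this ⊢
  rw [mul_smul, mul_smul, this, smul_inv_smul]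

end StabilizerConnected

open LinearMap.GeneralLinearGroup

/-- A point has finite orbit under a subgroup iff its stabilizer has finite relative index. -/
theorem relIndex_stabilizer_ne_zero_iff {Γ X : Type*} [Group Γ] [MulAction Γ X] (G : Subgroup Γ)
    (x : X) : (stabilizer Γ x).relIndex G ≠ 0 ↔ (orbit G x).Finite := by
  have h : (stabilizer Γ x).subgroupOf G = stabilizer G x := by ext; rfl
  rw [Subgroup.relIndex, h]
  constructor
  · intro h0
    have : (stabilizer G x).FiniteIndex := ⟨h0⟩
    exact Finite.of_equiv _ (orbitEquivQuotientStabilizer G x).symm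
  · intro hf
    rw [index_stabilizer]
    exact (Set.ncard_pos hf).2 (nonempty_orbit x) |>.ne'

/-! ### Weight spaces of normal subgroups -/

section WeightSpace

variable {k V : Type*} [Field k] [AddCommGroup V] [Module k V]

/-- The simultaneous eigenspace of a linear group for a character. -/
def weightSpace (N : Subgroup (LinearMap.GeneralLinearGroup k V)) (χ : N →* k) :
    Submodule k V where
  carrier := {x | ∀ n : N, n • x = χ n • x}
  add_mem' := fun ha hb n => by rw [smul_add, smul_add, ha n, hb n]
  zero_mem' := fun n => by rw [smul_zero, smul_zero]
  smul_mem' := fun c x hx n => by rw [smul_comm (χ n), ← hx n, smul_comm]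

theorem mem_weightSpace {N : Subgroup (LinearMap.GeneralLinearGroup k V)} {χ : N →* k} {x : V} :
    x ∈ weightSpace N χ ↔ ∀ n : N, n • x = χ n • x := Iff.rfl

/-- Only finitely many weight spaces are nonzero. -/
theorem finite_setOf_weightSpace_ne_bot [FiniteDimensional k V]
    (N : Subgroup (LinearMap.GeneralLinearGroup k V)) :
    {χ : N →* k | weightSpace N χ ≠ ⊥}.Finite := by
  have hex : ∀ χ : {χ : N →* k | weightSpace N χ ≠ ⊥}, ∃ v ∈ weightSpace N χ.1, v ≠ 0 :=
    fun χ => (Submodule.ne_bot_iff _).1 χ.2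
  choose v hv hv0 using hex
  refine LinearIndependent.finite (R := k) (f := v) ?_
  rw [linearIndependent_iff']
  intro s a hsum χ hχ
  -- Dedekind's independence of characters: translating a relation by `n` and applying a functional
  -- `φ` gives a relation among the characters with coefficients `φ (a ψ • v ψ)`.
  have hli := (linearIndependent_monoidHom N k).comp
    (Subtype.val : {χ : N →* k | weightSpace N χ ≠ ⊥} → (N →* k)) Subtype.val_injective
  rw [linearIndependent_iff'] at hli
  have hdual : ∀ φ : Module.Dual k V, φ (a χ • v χ) = 0 := by
    intro φ
    have := hli s (fun ψ => φ (a ψ • v ψ)) ?_ χ hχ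
    · exact this
    · ext n
      have h1 := congrArg (fun x => φ (n • x)) hsum
      simp only [smul_zero, map_zero, Finset.smul_sum, map_sum] at h1
      rw [Finset.sum_apply, Pi.zero_apply, ← h1]
      refine Finset.sum_congr rfl fun ψ _ => ?_
      rw [smul_comm n (a ψ), hv ψ n]
      simp
      ring
  have := (Module.forall_dual_apply_eq_zero_iff k _).1 hdual
  exact (smul_eq_zero.1 this).resolve_right (hv0 χ)

/-- An element normalizing `N` maps weight spaces of `N` to weight spaces. -/
theorem exists_smul_weightSpace_eq {N : Subgroup (LinearMap.GeneralLinearGroup k V)}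
    (χ : N →* k) {g : LinearMap.GeneralLinearGroup k V}
    (hg : ∀ n ∈ N, g * n * g⁻¹ ∈ N) (hg' : ∀ n ∈ N, g⁻¹ * n * g ∈ N) :
    ∃ χ' : N →* k, g • weightSpace N χ = weightSpace N χ' := by
  let c : N →* N := MonoidHom.mk' (fun n => ⟨g⁻¹ * n * g, hg' n n.2⟩) fun a b => by
    ext1; simp [mul_assoc]
  refine ⟨χ.comp c, ?_⟩
  ext y
  constructor
  · rintro ⟨x, hx, rfl⟩ n
    have h := mem_weightSpace.1 hx (c n)
    change (n : LinearMap.GeneralLinearGroup k V) • (g • x) = χ (c n) • (g • x)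
    rw [smul_comm (χ (c n)) g, ← h]
    change _ = g • ((g⁻¹ * n * g : LinearMap.GeneralLinearGroup k V) • x)
    simp only [smul_smul, mul_assoc, mul_inv_cancel_left]
  · intro hy
    refine ⟨g⁻¹ • y, fun n => ?_, smul_inv_smul g y⟩
    have h := mem_weightSpace.1 hy ⟨g * n * g⁻¹, hg n n.2⟩
    have hc : c ⟨g * n * g⁻¹, hg n n.2⟩ = n := by ext1; simp [c, mul_assoc]
    rw [MonoidHom.comp_apply, hc] at h
    change (n : LinearMap.GeneralLinearGroup k V) • (g⁻¹ • y) = _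
    rw [smul_comm (χ n), ← h]
    change _ = g⁻¹ • ((g * n * g⁻¹ : LinearMap.GeneralLinearGroup k V) • y)
    simp only [smul_smul, mul_assoc, inv_mul_cancel_left]

/-- A stabilizer-connected group stabilizes the nonzero weight spaces of its normal subgroups. -/
theorem IsStabilizerConnected.le_stabilizer_weightSpace [FiniteDimensional k V]
    {G N : Subgroup (LinearMap.GeneralLinearGroup k V)} (hG : IsStabilizerConnected G)
    (hN : ∀ g ∈ G, ∀ n ∈ N, g * n * g⁻¹ ∈ N) {χ : N →* k} (hχ : weightSpace N χ ≠ ⊥) :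
    G ≤ stabilizer (LinearMap.GeneralLinearGroup k V) (weightSpace N χ) := by
  refine hG _ ((relIndex_stabilizer_ne_zero_iff G _).2
    (((finite_setOf_weightSpace_ne_bot N).image (weightSpace N)).subset ?_))
  rintro _ ⟨g, rfl⟩
  obtain ⟨χ', h⟩ := exists_smul_weightSpace_eq χ (hN g g.2)
    (fun n hn => by simpa using hN _ (inv_mem g.2) n hn)
  refine ⟨χ', ?_, h.symm⟩
  rw [Set.mem_ofPred_eq, ← h]
  intro h0
  refine hχ ((Submodule.eq_bot_iff _).2 fun x hx => ?_)
  have : (g : LinearMap.GeneralLinearGroup k V) • x ∈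
      (g : LinearMap.GeneralLinearGroup k V) • weightSpace N χ := ⟨x, hx, rfl⟩
  rw [h0, Submodule.mem_bot] at this
  exact (smul_eq_zero_iff_eq _).1 this

/-- If the commutator subgroup element `n` of a group `G` stabilizing `W` acts on `W` by a scalar,
then the `dim W`-th power of the scalar is one. -/
theorem pow_finrank_eq_one_of_mem_commutator [FiniteDimensional k V]
    {G : Subgroup (LinearMap.GeneralLinearGroup k V)} {W : Submodule k V}
    (hW : G ≤ stabilizer (LinearMap.GeneralLinearGroup k V) W)
    {n : LinearMap.GeneralLinearGroup k V} (hn : n ∈ ⁅G, G⁆) {c : k}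
    (hc : ∀ x ∈ W, n • x = c • x) : c ^ Module.finrank k W = 1 := by
  have hst : ∀ g ∈ G, ∀ x ∈ W, (g : V →ₗ[k] V) x ∈ W := fun g hg =>
    (mem_stabilizer_submodule_iff g W).1 (hW hg)
  let r : G →* Module.End k W :=
    { toFun := fun g => (g.1 : V →ₗ[k] V).restrict (hst g g.2)
      map_one' := by ext; rfl
      map_mul' := fun _ _ => by ext; rfl }
  -- The determinant on `W` has abelian target, so it is trivial on commutators; on the scalar `c`
  -- it is `c ^ dim W`.
  let d : G →* kˣ := ((LinearMap.det : Module.End k W →* k).comp r).toHomUnits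
  rw [← Subgroup.map_subtype_commutator] at hn
  obtain ⟨m, hm, rfl⟩ := hn
  have h1 : d m = 1 := Abelianization.commutator_subset_ker d hm
  have h2 : LinearMap.det (r m) = 1 := congrArg Units.val h1
  have h3 : r m = c • LinearMap.id := by
    ext x
    exact hc x x.2
  rw [h3, LinearMap.det_smul, LinearMap.det_id, mul_one] at h2
  exact h2

end WeightSpace

/-! ### Induction on the derived length -/

section Solvable

/-- The derived series inside an ambient group. -/
theorem map_subtype_derivedSeries {Γ : Type*} [Group Γ] (G : Subgroup Γ) (n : ℕ) :
    (derivedSeries G n).map G.subtype = (fun H : Subgroup Γ => ⁅H, H⁆)^[n] G := by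
  induction n with
  | zero => simp [← MonoidHom.range_eq_map]
  | succ n ih =>
    rw [derivedSeries_succ, Subgroup.map_commutator, ih, Function.iterate_succ_apply']

open scoped commutatorElement in
theorem conj_mem_commutator_self {Γ : Type*} [Group Γ] {G : Subgroup Γ} {g a : Γ} (hg : g ∈ G)
    (ha : a ∈ ⁅G, G⁆) : g * a * g⁻¹ ∈ ⁅G, G⁆ := by
  -- The conjugate is `⁅g, a⁆ * a`.
  have := mul_mem (Subgroup.commutator_mem_commutator hg (Subgroup.commutator_le_self G ha)) ha
  simpa [commutatorElement_def, mul_assoc] using this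

theorem iterate_commutator_mono {Γ : Type*} [Group Γ] (n : ℕ) :
    Monotone ((fun H : Subgroup Γ => ⁅H, H⁆)^[n]) :=
  Monotone.iterate (fun _ _ h => Subgroup.commutator_mono h h) n

variable {V : Type*} [AddCommGroup V] [Module ℝ V] [TopologicalSpace V] {C : Set V}

/-- A vector of the cone with finite orbit under `G` yields a `G`-fixed nonzero vector of the
cone. -/
theorem IsStrictlyConvexClosedCone.exists_fixed_of_finite_orbit
    (hC : IsStrictlyConvexClosedCone C) {G : Subgroup (LinearMap.GeneralLinearGroup ℝ V)}
    (hGC : ∀ g ∈ G, ∀ x ∈ C, g • x ∈ C) {v : V} (hv : v ∈ C) (hv0 : v ≠ 0)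
    (hfin : (orbit G v).Finite) : ∃ w ∈ C, w ≠ 0 ∧ ∀ g ∈ G, g • w = w := by
  classical
  have horb : ∀ x ∈ hfin.toFinset, x ∈ C := by
    intro x hx
    obtain ⟨g, rfl⟩ := hfin.mem_toFinset.1 hx
    exact hGC g g.2 v hv
  refine ⟨∑ x ∈ hfin.toFinset, x, hC.sum_mem _ _ horb, fun h0 => hv0 ?_, fun g hg => ?_⟩
  · have hmem : v ∈ hfin.toFinset := hfin.mem_toFinset.2 (mem_orbit_self v)
    rw [← Finset.add_sum_erase _ _ hmem] at h0
    exact hC.eq_zero_of_add_eq_zero hv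
      (hC.sum_mem _ _ fun x hx => horb x (Finset.mem_of_mem_erase hx)) h0
  · rw [Finset.smul_sum]
    refine Finset.sum_bij (fun x _ => g • x) ?_ ?_ ?_ fun _ _ => rfl
    · intro x hx
      rw [hfin.mem_toFinset] at hx ⊢
      exact mem_orbit_of_mem_orbit (⟨g, hg⟩ : G) hx
    · intro x _ y _ h
      exact MulAction.injective g h
    · intro y hy
      rw [hfin.mem_toFinset] at hy
      exact ⟨g⁻¹ • y, hfin.mem_toFinset.2 (mem_orbit_of_mem_orbit (⟨g, hg⟩⁻¹ : G) hy),
        smul_inv_smul g y⟩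

/-- An eigenvector in the cone of a linear automorphism preserving the cone has positive
eigenvalue. -/
theorem IsStrictlyConvexClosedCone.eigenvalue_pos (hC : IsStrictlyConvexClosedCone C)
    {g : LinearMap.GeneralLinearGroup ℝ V} (hg : ∀ x ∈ C, g • x ∈ C) {v : V} (hv : v ∈ C)
    (hv0 : v ≠ 0) {c : ℝ} (hc : g • v = c • v) : 0 < c := by
  by_contra! hle
  have h1 : -(c • v) ∈ C := by
    rw [← neg_smul]
    exact hC.smul_mem _ (by linarith) v hv
  have h2 : c • v = 0 := hC.eq_zero_of_neg_mem (hc ▸ hg v hv) h1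
  exact hv0 ((smul_eq_zero_iff_eq g).1 (hc.trans h2))

variable [FiniteDimensional ℝ V] [IsTopologicalAddGroup V] [ContinuousSMul ℝ V] [T2Space V]

open scoped commutatorElement in
/-- A group preserving the cone whose commutator subgroup has a nonzero fixed vector in the cone
has a common eigenvector in the cone. -/
theorem IsStrictlyConvexClosedCone.exists_eigenvector_of_commutator_fixed
    (hC : IsStrictlyConvexClosedCone C) {G : Subgroup (LinearMap.GeneralLinearGroup ℝ V)}
    (hGC : ∀ g ∈ G, ∀ x ∈ C, g • x ∈ C) {w : V} (hw : w ∈ C) (hw0 : w ≠ 0)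
    (hfix : ∀ g ∈ ⁅G, G⁆, g • w = w) :
    ∃ v ∈ C, v ≠ 0 ∧ ∀ g ∈ G, ∃ c : ℝ, g • v = c • v := by
  let F : Submodule ℝ V :=
    { carrier := {x | ∀ g ∈ ⁅G, G⁆, g • x = x}
      add_mem' := fun ha hb g hg => by rw [smul_add, ha g hg, hb g hg]
      zero_mem' := fun g _ => smul_zero g
      smul_mem' := fun c x hx g hg => by rw [smul_comm, hx g hg] }
  have hF : ∀ x, x ∈ F ↔ ∀ g ∈ ⁅G, G⁆, g • x = x := fun x => Iff.rfl
  have hFG : ∀ g ∈ G, ∀ x ∈ F, g • x ∈ F := by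
    intro g hg x hx a ha
    have hmem : g⁻¹ * a * g ∈ ⁅G, G⁆ := by simpa using conj_mem_commutator_self (inv_mem hg) ha
    calc a • g • x = g • ((g⁻¹ * a * g) • x) := by
          simp only [smul_smul, mul_assoc, mul_inv_cancel_left]
      _ = g • x := by rw [hx _ hmem]
  have hcone : IsStrictlyConvexClosedCone (C ∩ F) :=
    hC.of_subset Set.inter_subset_left ⟨w, hw, hfix⟩
      (hC.isClosed.inter F.closed_of_finiteDimensional)
      (fun x hx y hy => ⟨hC.add_mem x hx.1 y hy.1, F.add_mem hx.2 hy.2⟩)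
      (fun c hc x hx => ⟨hC.smul_mem c hc x hx.1, F.smul_mem c hx.2⟩)
  obtain ⟨v, hv, hv0, h⟩ := hcone.exists_common_eigenvector
    (fun h0 => hw0 (by
      have : w ∈ C ∩ F := ⟨hw, hfix⟩
      rw [h0] at this
      exact this))
    ((fun g : LinearMap.GeneralLinearGroup ℝ V => (g : V →ₗ[ℝ] V)) '' G)
    (by
      rintro _ ⟨g, hg, rfl⟩ x hx
      exact ⟨hGC g hg x hx.1, hFG g hg x hx.2⟩)
    (by
      rintro _ ⟨g, hg, rfl⟩ _ ⟨h, hh, rfl⟩ x hx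
      change g • h • x = h • g • x
      -- This commutator satisfies `h * g * ⁅g⁻¹, h⁻¹⁆ = g * h` and fixes `x`.
      have hmem : ⁅g⁻¹, h⁻¹⁆ ∈ ⁅G, G⁆ :=
        Subgroup.commutator_mem_commutator (inv_mem hg) (inv_mem hh)
      have := congrArg (fun y => (h * g) • y) (hx.2 _ hmem)
      simpa [commutatorElement_def, smul_smul, mul_assoc] using this)
  exact ⟨v, hv.1, hv0, fun g hg => h _ ⟨g, hg, rfl⟩⟩

/-- Iterating the commutator inside the fixed ambient group lets the induction pass to smaller
subgroups of `GL(V)` by monotonicity alone. -/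
theorem IsStrictlyConvexClosedCone.exists_eigenvector_of_iterate_commutator
    (hC : IsStrictlyConvexClosedCone C) (hC0 : C ≠ {0}) (m : ℕ) :
    ∀ G : Subgroup (LinearMap.GeneralLinearGroup ℝ V),
      (fun H : Subgroup (LinearMap.GeneralLinearGroup ℝ V) => ⁅H, H⁆)^[m] G = ⊥ →
      IsStabilizerConnected G → (∀ g ∈ G, ∀ x ∈ C, g • x ∈ C) →
      ∃ v ∈ C, v ≠ 0 ∧ ∀ g ∈ G, ∃ c : ℝ, g • v = c • v := by
  induction m with
  | zero =>
    intro G hG _ _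
    obtain ⟨v, hv, hv0⟩ := hC.exists_ne_zero hC0
    refine ⟨v, hv, hv0, fun g hg => ⟨1, ?_⟩⟩
    obtain rfl : G = ⊥ := hG
    rw [Subgroup.mem_bot.1 hg, one_smul, one_smul]
  | succ m ih =>
    intro G hG hconn hGC
    have hcomm_le : ⁅G, G⁆ ≤ G := Subgroup.commutator_le_self G
    -- The commutator subgroup need not inherit stabilizer-connectedness, so the induction
    -- hypothesis is applied to its component.
    set N := stabilizerComponent ⁅G, G⁆ with hN
    have hNle : N ≤ ⁅G, G⁆ := stabilizerComponent_le _
    have hnorm : ∀ g ∈ G, ∀ n ∈ N, g * n * g⁻¹ ∈ N := by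
      intro g hg n hn
      refine conj_mem_stabilizerComponent ?_ hn
      refine Subgroup.mem_normalizer_iff.2 fun a => ⟨conj_mem_commutator_self hg, fun h => ?_⟩
      simpa [mul_assoc] using conj_mem_commutator_self (inv_mem hg) h
    obtain ⟨v, hv, hv0, heig⟩ := ih N
      (le_bot_iff.1 ((iterate_commutator_mono m hNle).trans hG.le))
      (isStabilizerConnected_stabilizerComponent _)
      (fun g hg => hGC g (hcomm_le (hNle hg)))
    choose! χ₀ hχ₀ using heig
    let χ : N →* ℝ :=
      { toFun := fun n => χ₀ n
        map_one' := by
          refine smul_left_injective ℝ hv0 ?_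
          change χ₀ 1 • v = (1 : ℝ) • v
          rw [← hχ₀ 1 (one_mem N), one_smul, one_smul]
        map_mul' := fun a b => by
          refine smul_left_injective ℝ hv0 ?_
          change χ₀ (a * b) • v = (χ₀ a * χ₀ b) • v
          rw [← hχ₀ _ (mul_mem a.2 b.2), mul_smul, hχ₀ b b.2, smul_comm, hχ₀ a a.2, smul_smul,
            mul_comm] }
    have hvW : v ∈ weightSpace N χ := fun n => hχ₀ n n.2
    have hWbot : weightSpace N χ ≠ ⊥ := (Submodule.ne_bot_iff _).2 ⟨v, hvW, hv0⟩
    have hW := hconn.le_stabilizer_weightSpace hnorm hWbot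
    have hNfix : N ≤ stabilizer (LinearMap.GeneralLinearGroup ℝ V) v := by
      intro n hn
      have hpow := pow_finrank_eq_one_of_mem_commutator hW (hNle hn)
        (c := χ₀ n) fun x hx => mem_weightSpace.1 hx ⟨n, hn⟩
      have hpos : 0 < χ₀ n :=
        hC.eigenvalue_pos (hGC n (hcomm_le (hNle hn))) hv hv0 (hχ₀ n hn)
      have hd : Module.finrank ℝ (weightSpace N χ) ≠ 0 := by
        rwa [Ne, Submodule.finrank_eq_zero]
      rw [mem_stabilizer_iff, hχ₀ n hn, (pow_eq_one_iff_of_nonneg hpos.le hd).1 hpow, one_smul]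
    -- The stabilizer of `v` contains `N`, which has finite index in `⁅G, G⁆`.
    have hfin : (orbit (⁅G, G⁆ : Subgroup _) v).Finite :=
      (relIndex_stabilizer_ne_zero_iff _ v).1 fun h0 =>
        relIndex_stabilizerComponent_ne_zero ⁅G, G⁆ (Subgroup.relIndex_eq_zero_of_le_left hNfix h0)
    obtain ⟨w, hw, hw0, hfix⟩ :=
      hC.exists_fixed_of_finite_orbit (fun g hg => hGC g (hcomm_le hg)) hv hv0 hfin
    exact hC.exists_eigenvector_of_commutator_fixed hGC hw hw0 hfix

/-- A stabilizer-connected solvable group preserving a nonzero strictly convex closed cone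
has a common eigenvector in the cone, and it preserves the half-line spanned by it. -/
theorem IsStrictlyConvexClosedCone.exists_invariant_halfLine
    (hC : IsStrictlyConvexClosedCone C) (hC0 : C ≠ {0})
    {G : Subgroup (LinearMap.GeneralLinearGroup ℝ V)} (hconn : IsStabilizerConnected G)
    (hsolv : Group.IsSolvable G) (hGC : ∀ g ∈ G, ∀ x ∈ C, g • x ∈ C) :
    ∃ v ∈ C \ {0}, ∀ g ∈ G, (g : V →ₗ[ℝ] V) '' halfLine v = halfLine v := by
  obtain ⟨m, hm⟩ := hsolv.solvable
  obtain ⟨v, hv, hv0, heig⟩ := hC.exists_eigenvector_of_iterate_commutator hC0 m G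
    (by rw [← map_subtype_derivedSeries, hm, Subgroup.map_bot]) hconn hGC
  refine ⟨v, ⟨hv, hv0⟩, fun g hg => ?_⟩
  obtain ⟨c, hc⟩ := heig g hg
  have hpos := hC.eigenvalue_pos (hGC g hg) hv hv0 hc
  have hc' : (g : V →ₗ[ℝ] V) v = c • v := hc
  ext x
  constructor
  · rintro ⟨_, ⟨a, ha, rfl⟩, rfl⟩
    exact ⟨a * c, by positivity, by rw [map_smul, hc', smul_smul]⟩
  · rintro ⟨a, ha, rfl⟩
    exact ⟨(a / c) • v, ⟨a / c, by positivity, rfl⟩, by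
      rw [map_smul, hc', smul_smul, div_mul_cancel₀ _ hpos.ne']⟩

end Solvable

/-! ### Zariski connectedness implies stabilizer-connectedness -/

section ZariskiConnected

/-- The set of automorphisms mapping `W` into `W'` is Zariski closed. -/
theorem isClosed_setOf_smul_le {k E : Type*} [Field k] [AddCommGroup E] [Module k E]
    (W W' : Submodule k E) :
    IsClosed[zariskiTopologyGL k E] {z : LinearMap.GeneralLinearGroup k E | z • W ≤ W'} := by
  let _ := zariskiTopology k (Module.End k E)
  refine isClosed_induced_iff.2 ⟨commonZeros {f | ∃ φ ∈ W'.dualAnnihilator, ∃ u ∈ W,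
    f = fun a : Module.End k E => φ (a u)}, ?_, ?_⟩
  · refine isOpen_compl_iff.1 ?_
    change (_ᶜ)ᶜ ∈ {Z | ∃ S : Set (Module.End k E → k), S ⊆ polyFunAlgebra k (Module.End k E) ∧
      Z = commonZeros S}
    rw [compl_compl]
    refine ⟨_, ?_, rfl⟩
    rintro _ ⟨φ, -, u, -, rfl⟩
    exact Algebra.subset_adjoin ⟨φ ∘ₗ LinearMap.applyₗ u, fun a => rfl⟩
  · ext z
    constructor
    · rintro h _ ⟨u, hu, rfl⟩
      refine (Subspace.forall_mem_dualAnnihilator_apply_eq_zero_iff W' _).1 fun φ hφ => ?_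
      exact h _ ⟨φ, hφ, u, hu, rfl⟩
    · rintro h _ ⟨φ, hφ, u, hu, rfl⟩
      exact (Subspace.forall_mem_dualAnnihilator_apply_eq_zero_iff W' _).2 (h ⟨u, hu, rfl⟩) φ hφ

/-- If the Zariski closure of a group is connected, then the group stabilizes every subspace with
finite orbit. -/
theorem smul_eq_of_isPreconnected_closure {k E : Type*} [Field k] [AddCommGroup E] [Module k E]
    [FiniteDimensional k E] (G : Subgroup (LinearMap.GeneralLinearGroup k E))
    (hG : letI := zariskiTopologyGL k E
      IsPreconnected (closure (G : Set (LinearMap.GeneralLinearGroup k E))))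
    (W : Submodule k E) (hW : (orbit G W).Finite) {g : LinearMap.GeneralLinearGroup k E}
    (hg : g ∈ G) : g • W = W := by
  let _ := zariskiTopologyGL k E
  have hrank : ∀ W' ∈ orbit G W, Module.finrank k W = Module.finrank k W' := by
    rintro _ ⟨h, rfl⟩
    exact (LinearEquiv.finrank_map_eq
      (LinearMap.GeneralLinearGroup.toLinearEquiv (h : LinearMap.GeneralLinearGroup k E)) W).symm
  -- The closure is covered by two closed sets, `{z | z • W ≤ W}` and the finite union `B`. They are
  -- disjoint because equality of dimensions turns each inclusion into an equality; an element
  -- moving `W` would make both meet the closure.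
  let B : Set (LinearMap.GeneralLinearGroup k E) := ⋃ W' ∈ orbit G W \ {W}, {z | z • W ≤ W'}
  have hA : IsClosed {z : LinearMap.GeneralLinearGroup k E | z • W ≤ W} :=
    isClosed_setOf_smul_le W W
  have hB : IsClosed B :=
    hW.sdiff.isClosed_biUnion fun W' _ => isClosed_setOf_smul_le W W'
  have hcover : closure (G : Set (LinearMap.GeneralLinearGroup k E)) ⊆ {z | z • W ≤ W} ∪ B := by
    refine closure_minimal (fun z hz => ?_) (hA.union hB)
    by_cases h : z • W = W
    · exact Or.inl h.le
    · exact Or.inr (Set.mem_biUnion (x := z • W) ⟨⟨⟨z, hz⟩, rfl⟩, h⟩ (le_refl (z • W)))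
  by_contra hne
  obtain ⟨z, -, hzA, hzB⟩ := isPreconnected_closed_iff.1 hG _ _ hA hB hcover
    ⟨1, subset_closure (one_mem G), (one_smul _ W).le⟩
    ⟨g, subset_closure hg, Set.mem_biUnion (x := g • W) ⟨⟨⟨g, hg⟩, rfl⟩, hne⟩ (le_refl (g • W))⟩
  obtain ⟨W', ⟨hW', hW'ne⟩, hz⟩ := Set.mem_iUnion₂.1 hzB
  exact hW'ne ((smul_submodule_eq_of_le z (hrank W' hW') hz).symm.trans
    (smul_submodule_eq_of_le z rfl hzA))

/-- A functional vanishing on `U` has a base change vanishing on `U.baseChange ℂ`, so membership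
descends to the real space. -/
theorem one_tmul_mem_baseChange_iff {V : Type*} [AddCommGroup V] [Module ℝ V]
    (U : Submodule ℝ V) (x : V) : (1 : ℂ) ⊗ₜ[ℝ] x ∈ U.baseChange ℂ ↔ x ∈ U := by
  refine ⟨fun h => ?_, fun h => Submodule.tmul_mem_baseChange_of_mem 1 h⟩
  refine (Subspace.forall_mem_dualAnnihilator_apply_eq_zero_iff U x).1 fun φ hφ => ?_
  have hle : U.baseChange ℂ ≤ LinearMap.ker (φ.baseChange ℂ) := by
    rw [Submodule.baseChange_eq_span, Submodule.span_le]
    rintro _ ⟨u, hu, rfl⟩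
    have : φ u = 0 := (Submodule.mem_dualAnnihilator φ).1 hφ u hu
    simp [this]
  have h1 := hle h
  simpa using h1

theorem complexifyGL_smul_baseChange {V : Type*} [AddCommGroup V] [Module ℝ V]
    (g : LinearMap.GeneralLinearGroup ℝ V) (U : Submodule ℝ V) :
    complexifyGL V g • U.baseChange ℂ = (g • U).baseChange ℂ := by
  change (U.baseChange ℂ).map ((g : V →ₗ[ℝ] V).baseChange ℂ) =
    (U.map (g : V →ₗ[ℝ] V)).baseChange ℂ
  rw [Submodule.baseChange_eq_span, Submodule.baseChange_eq_span, Submodule.map_span]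
  congr 1
  ext y
  constructor
  · rintro ⟨_, ⟨u, hu, rfl⟩, rfl⟩
    exact ⟨(g : V →ₗ[ℝ] V) u, ⟨u, hu, rfl⟩, rfl⟩
  · rintro ⟨_, ⟨u, hu, rfl⟩, rfl⟩
    exact ⟨_, ⟨u, hu, rfl⟩, rfl⟩

/-- A finite orbit of `U` gives a finite orbit of its complexification, where the connected closure
acts; the resulting stability then descends to `U`. -/
theorem IsZariskiConnected.isStabilizerConnected {V : Type*} [AddCommGroup V] [Module ℝ V]
    [FiniteDimensional ℝ V] {G : Subgroup (LinearMap.GeneralLinearGroup ℝ V)}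
    (hG : IsZariskiConnected G) : IsStabilizerConnected G := by
  intro U hU g hg
  rw [relIndex_stabilizer_ne_zero_iff] at hU
  let _ := zariskiTopologyGL ℂ (ℂ ⊗[ℝ] V)
  have hpre : IsPreconnected (closure
      ((G.map (complexifyGL V) : Subgroup _) : Set (LinearMap.GeneralLinearGroup ℂ (ℂ ⊗[ℝ] V)))) :=
    IsConnected.isPreconnected hG
  have hfin : (orbit (G.map (complexifyGL V)) (U.baseChange ℂ)).Finite := by
    refine (hU.image fun U' : Submodule ℝ V => U'.baseChange ℂ).subset ?_
    rintro _ ⟨⟨_, h, hh, rfl⟩, rfl⟩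
    exact ⟨h • U, ⟨⟨h, hh⟩, rfl⟩, (complexifyGL_smul_baseChange h U).symm⟩
  have heq := smul_eq_of_isPreconnected_closure _ hpre _ hfin (Subgroup.mem_map_of_mem _ hg)
  refine (mem_stabilizer_submodule_iff g U).2 fun u hu => ?_
  rw [← one_tmul_mem_baseChange_iff, ← heq, complexifyGL_smul_baseChange]
  exact Submodule.tmul_mem_baseChange_of_mem 1 ⟨u, hu, rfl⟩

end ZariskiConnected

theorem theorem2p1 {V : Type*} [AddCommGroup V] [Module ℝ V] [FiniteDimensional ℝ V]
    [TopologicalSpace V] [IsTopologicalAddGroup V] [ContinuousSMul ℝ V] [T2Space V]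
    (C : Set V) (hC : IsStrictlyConvexClosedCone C) (hC0 : C ≠ {0})
    (G : Subgroup (LinearMap.GeneralLinearGroup ℝ V)) (hG : IsVirtuallySolvable G)
    (hGC : ∀ g ∈ G, (g : V →ₗ[ℝ] V) '' C ⊆ C) :
    (∃ H : Subgroup (LinearMap.GeneralLinearGroup ℝ V),
      H ≤ G ∧ (H.subgroupOf G).FiniteIndex ∧
        ∃ v ∈ C \ {0}, ∀ h ∈ H, (h : V →ₗ[ℝ] V) '' halfLine v = halfLine v) ∧
    (IsZariskiConnected G → Group.IsSolvable G →
      ∃ v ∈ C \ {0}, ∀ g ∈ G, (g : V →ₗ[ℝ] V) '' halfLine v = halfLine v) := by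
  have hGC' : ∀ g ∈ G, ∀ x ∈ C, g • x ∈ C := fun g hg x hx => hGC g hg ⟨x, hx, rfl⟩
  refine ⟨?_, fun hconn hsolv => hC.exists_invariant_halfLine hC0 hconn.isStabilizerConnected
    hsolv hGC'⟩
  obtain ⟨K, hKfin, hKsolv⟩ := hG
  set K' := K.map G.subtype with hK'
  have hK'G : K' ≤ G := Subgroup.map_subtype_le K
  have hN : stabilizerComponent K' ≤ K' := stabilizerComponent_le K'
  have hKindex : K'.relIndex G ≠ 0 := by
    rw [Subgroup.relIndex, hK', ← Subgroup.comap_subtype,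
      Subgroup.comap_map_eq_self_of_injective G.subtype_injective]
    exact hKfin.index_ne_zero
  -- `H` is the component of the finite-index solvable subgroup: it is again solvable, and of finite
  -- index in `G` by transitivity.
  refine ⟨stabilizerComponent K', hN.trans hK'G, ⟨?_⟩, ?_⟩
  · exact Subgroup.relIndex_ne_zero_trans (relIndex_stabilizerComponent_ne_zero K') hKindex
  · have hK'solv : Group.IsSolvable K' :=
      Group.isSolvable_of_surjective
        (f := (K.equivMapOfInjective G.subtype G.subtype_injective).toMonoidHom)
        (K.equivMapOfInjective G.subtype G.subtype_injective).surjective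
    refine hC.exists_invariant_halfLine hC0 (isStabilizerConnected_stabilizerComponent K')
      (Group.isSolvable_of_isSolvable_injective (Subgroup.inclusion_injective hN))
      fun g hg => hGC' g (hK'G (hN hg))
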